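/- \textbf{Theorem.} An oriented line in the plane is a pair $(\boldsymbol v,d)$ with $|\boldsymbol v|=1$, representing $\{\boldsymbol x\in\mathbb R^2:(\boldsymbol v,\boldsymbol x)=d\}$ and regarded as the point $(v,w,d)\in\mathbb R^3$, $\boldsymbol v=(v,w)$, of the cylinder $v^2+w^2=1$. An oriented circle with centre $\boldsymbol c$ and signed radius $r\in\mathbb R$ (zero allowed) is in oriented contact with it if $(\boldsymbol c,\boldsymbol v)-r=d$. Two families $(\ell_i)_{i\in\mathbb Z}$, $(m_j)_{j\in\mathbb Z}$ of oriented lines form a checkerboard IC-net if for all integers $k,n$ the lines $\ell_{2k},\ell_{2k+1},m_{2n},m_{2n+1}$, and also the lines $\ell_{2k-1},\ell_{2k},m_{2n-1},m_{2n}$, have a common oriented circle in oriented contact; the net is confocal if, moreover, all its lines are tangent to one nondegenerate conic. Let $\alpha\ge\beta>0$, $k=\sqrt{1-\beta^2/\alpha^2}$, and for real $\psi$ put $\boldsymbol v_\pm(\psi)=(\mathrm{cn}(\psi,k),\,\mathrm{sn}(\psi,k),\,\pm\alpha\,\mathrm{dn}(\psi,k))$, with the Jacobi elliptic functions of modulus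 $k$. Let $\psi_0^v,\psi_0^h,s,\tilde s$ be real numbers with $\mathrm{sn}(s/2,k)\ne0$ and $\mathrm{sn}(\tilde s/2,k)\ne0$, and define, for $n\in\mathbb Z$, $$\ell_{2n}=\boldsymbol v_+(\psi_0^v+n(s+\tilde s)),\qquad \ell_{2n+1}=\boldsymbol v_-(\psi_0^v+n(s+\tilde s)+s),$$ $$m_{2n}=\boldsymbol v_+(\psi_0^h-n(s+\tilde s)),\qquad m_{2n+1}=\boldsymbol v_-(\psi_0^h-n(s+\tilde s)-s).$$ Then: (1) For all $i,j\in\mathbb Z$ with $i+j$ even, the lines $\ell_i,\ell_{i+1},m_j,m_{j+1}$ have a common oriented circle in oriented contact if and only if $\ell_i$ and $m_{j+1}$ do not have the same unit normal. If $\ell_i$ and $m_j$ never have the same unit normal for $i+j$ odd, then the lines $\ell_i,m_j$ form a confocal checkerboard IC-net. (2) All lines $\ell_i$, $m_j$ are tangent to the ellipse $x^2/\alpha^2+y^2/\beta^2=1$. (3) The parameters $s,\tilde s$ determine the associated hyperboloids of the pencil $(\alpha^2+\lambda)v^2+(\beta^2+\lambda)w^2=d^2+\lambda$ (a cone if $\lambda=0$):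 for every $n\in\mathbb Z$, each of the straight lines in $\mathbb R^3$ joining the points $\ell_{2n},\ell_{2n+1}$ and joining $m_{2n},m_{2n+1}$ is contained in the quadric of the pencil with parameter $\lambda$ if and only if $\lambda=\alpha^2\,\mathrm{cs}^2(s/2,k)$, and each of the straight lines joining $\ell_{2n+1},\ell_{2n+2}$ and joining $m_{2n+1},m_{2n+2}$ is contained in it if and only if $\lambda=\alpha^2\,\mathrm{cs}^2(\tilde s/2,k)$. -/

import Mathlib

/-! ### Jacobi elliptic functions of a real argument `u` and modulus `k`, `0 ≤ k < 1` -/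

/-- The incomplete elliptic integral of the first kind,
`F(φ, k) = ∫₀^φ dθ / √(1 - k² sin² θ)`. -/
noncomputable def ellipticF (k φ : ℝ) : ℝ :=
  ∫ θ in (0 : ℝ)..φ, 1 / √(1 - k ^ 2 * Real.sin θ ^ 2)

/-- The Jacobi amplitude `am(u, k)`: the inverse function of `φ ↦ F(φ, k)`, which is a bijection of
the real line for `0 ≤ k < 1` (see `ellipticF_bijective`). -/
noncomputable def jacobiAm (u k : ℝ) : ℝ := Function.invFun (ellipticF k) u

/-- `sn(u, k) = sin am(u, k)`. -/
noncomputable def jacobiSn (u k : ℝ) : ℝ := Real.sin (jacobiAm u k)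

/-- `cn(u, k) = cos am(u, k)`. -/
noncomputable def jacobiCn (u k : ℝ) : ℝ := Real.cos (jacobiAm u k)

/-- `dn(u, k) = √(1 - k² sn²(u, k))`. -/
noncomputable def jacobiDn (u k : ℝ) : ℝ := √(1 - k ^ 2 * jacobiSn u k ^ 2)

/-- `cs(u, k) = cn(u, k) / sn(u, k)`, meaningful where `sn(u, k) ≠ 0`. -/
noncomputable def jacobiCs (u k : ℝ) : ℝ := jacobiCn u k / jacobiSn u k

theorem one_sub_sq_mul_sin_sq_pos {k : ℝ} (hk0 : 0 ≤ k) (hk1 : k < 1) (θ : ℝ) :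
    0 < 1 - k ^ 2 * Real.sin θ ^ 2 := by
  have h1 : Real.sin θ ^ 2 ≤ 1 := Real.sin_sq_le_one θ
  have h2 : k ^ 2 < 1 := by nlinarith
  nlinarith [sq_nonneg (Real.sin θ), sq_nonneg k]

theorem hasDerivAt_ellipticF {k : ℝ} (hk0 : 0 ≤ k) (hk1 : k < 1) (φ : ℝ) :
    HasDerivAt (ellipticF k) (1 / √(1 - k ^ 2 * Real.sin φ ^ 2)) φ := by
  have hc : Continuous fun θ : ℝ => 1 / √(1 - k ^ 2 * Real.sin θ ^ 2) := by
    refine continuous_const.div (by fun_prop) fun θ => ?_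
    exact (Real.sqrt_pos.2 (one_sub_sq_mul_sin_sq_pos hk0 hk1 θ)).ne'
  exact intervalIntegral.integral_hasDerivAt_right (hc.intervalIntegrable _ _)
    (hc.stronglyMeasurableAtFilter _ _) hc.continuousAt

theorem one_le_deriv_ellipticF {k : ℝ} (hk0 : 0 ≤ k) (hk1 : k < 1) (φ : ℝ) :
    1 ≤ 1 / √(1 - k ^ 2 * Real.sin φ ^ 2) := by
  have h := one_sub_sq_mul_sin_sq_pos hk0 hk1 φ
  rw [le_div_iff₀ (Real.sqrt_pos.2 h), one_mul, Real.sqrt_le_one]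
  nlinarith [mul_nonneg (sq_nonneg k) (sq_nonneg (Real.sin φ))]

theorem ellipticF_bijective {k : ℝ} (hk0 : 0 ≤ k) (hk1 : k < 1) :
    Function.Bijective (ellipticF k) := by
  have hd := hasDerivAt_ellipticF hk0 hk1
  have hmono : Monotone fun φ => ellipticF k φ - φ := by
    refine monotone_of_deriv_nonneg
      (fun φ => ((hd φ).sub (hasDerivAt_id φ)).differentiableAt) fun φ => ?_
    have h : deriv (fun φ => ellipticF k φ - φ) φ = _ := ((hd φ).sub (hasDerivAt_id φ)).deriv
    rw [h]
    linarith [one_le_deriv_ellipticF hk0 hk1 φ]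
  have h0 : ellipticF k 0 = 0 := by simp [ellipticF]
  refine ⟨?_, ?_⟩
  · refine StrictMono.injective fun a b hab => ?_
    have := hmono hab.le
    simp only at this
    linarith
  · have hcont : Continuous (ellipticF k) :=
      continuous_iff_continuousAt.2 fun φ => (hd φ).continuousAt
    refine hcont.surjective ?_ ?_
    · refine Filter.tendsto_atTop_mono' _ ?_ Filter.tendsto_id
      filter_upwards [Filter.eventually_ge_atTop (0 : ℝ)] with φ hφ
      have := hmono hφ
      simp only [h0] at this
      simp only [id]
      linarith
    · refine Filter.tendsto_atBot_mono' _ ?_ Filter.tendsto_id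
      filter_upwards [Filter.eventually_le_atBot (0 : ℝ)] with φ hφ
      have := hmono hφ
      simp only [h0] at this
      simp only [id]
      linarith

/-! ### Oriented lines and oriented circles in the plane -/

/-- The oriented line `{x | ⟪v, x⟫ = d}` with unit normal `v`; `(v, d)` and `(-v, -d)` are the two
orientations of the same line. -/
@[ext]
structure OrientedLine where
  normal : EuclideanSpace ℝ (Fin 2)
  norm_normal : ‖normal‖ = 1
  offset : ℝ

/-- The underlying set of points of an oriented line. -/
def OrientedLine.points (l : OrientedLine) : Set (EuclideanSpace ℝ (Fin 2)) :=
  {x | inner ℝ l.normal x = l.offset}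

/-- The point `(v, w, d)` of the Blaschke cylinder `v² + w² = 1` that represents a line. -/
def OrientedLine.toBlaschke (l : OrientedLine) : Fin 3 → ℝ :=
  ![l.normal 0, l.normal 1, l.offset]

/-- An oriented circle with signed radius; radius zero (a point) is allowed. -/
structure OrientedCircle where
  center : EuclideanSpace ℝ (Fin 2)
  radius : ℝ

/-- Oriented contact of an oriented circle and an oriented line: `⟪c, v⟫ - r = d`. -/
def OrientedContact (C : OrientedCircle) (l : OrientedLine) : Prop :=
  inner ℝ C.center l.normal - C.radius = l.offset

/-- Four oriented lines have a common oriented circle in oriented contact. -/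
def HaveCommonCircle (l₁ l₂ l₃ l₄ : OrientedLine) : Prop :=
  ∃ C : OrientedCircle,
    OrientedContact C l₁ ∧ OrientedContact C l₂ ∧ OrientedContact C l₃ ∧ OrientedContact C l₄

/-- Checkerboard IC-nets: every "black" quadrilateral of the two families of oriented lines has an
inscribed oriented circle. -/
def IsCheckerboardICNet (l m : ℤ → OrientedLine) : Prop :=
  ∀ k n : ℤ,
    HaveCommonCircle (l (2 * k)) (l (2 * k + 1)) (m (2 * n)) (m (2 * n + 1)) ∧
    HaveCommonCircle (l (2 * k - 1)) (l (2 * k)) (m (2 * n - 1)) (m (2 * n))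

/-! ### Conics and tangency -/

/-- The homogeneous coordinates `(x, y, 1)` of a point of the plane. -/
def homCoords (x : EuclideanSpace ℝ (Fin 2)) : Fin 3 → ℝ := ![x 0, x 1, 1]

/-- The conic `{x | (x, y, 1) A (x, y, 1)ᵀ = 0}` given by a symmetric 3 × 3 matrix. -/
def conicPoints (A : Matrix (Fin 3) (Fin 3) ℝ) : Set (EuclideanSpace ℝ (Fin 2)) :=
  {x | homCoords x ⬝ᵥ (A.mulVec (homCoords x)) = 0}

/-- A line is tangent to a nondegenerate conic if it is the tangent line (the polar line)
`{x | (p₁, p₂, 1) A (x, y, 1)ᵀ = 0}` at some point `p` of the conic. -/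
def IsTangentToConic (A : Matrix (Fin 3) (Fin 3) ℝ) (l : OrientedLine) : Prop :=
  ∃ p ∈ conicPoints A, l.points = {x | homCoords p ⬝ᵥ (A.mulVec (homCoords x)) = 0}

/-- A checkerboard IC-net is confocal if all its lines are tangent to one (nondegenerate) conic. -/
def IsConfocalCheckerboardICNet (l m : ℤ → OrientedLine) : Prop :=
  IsCheckerboardICNet l m ∧
    ∃ A : Matrix (Fin 3) (Fin 3) ℝ, A.IsSymm ∧ A.det ≠ 0 ∧
      ∀ i : ℤ, IsTangentToConic A (l i) ∧ IsTangentToConic A (m i)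

/-- The matrix of the ellipse `x²/α² + y²/β² = 1`. -/
noncomputable def ellipseMatrix (α β : ℝ) : Matrix (Fin 3) (Fin 3) ℝ :=
  Matrix.diagonal ![1 / α ^ 2, 1 / β ^ 2, -1]

theorem mem_conicPoints_ellipseMatrix (α β : ℝ) (x : EuclideanSpace ℝ (Fin 2)) :
    x ∈ conicPoints (ellipseMatrix α β) ↔ x 0 ^ 2 / α ^ 2 + x 1 ^ 2 / β ^ 2 = 1 := by
  have h : homCoords x ⬝ᵥ ((ellipseMatrix α β).mulVec (homCoords x)) =
      x 0 ^ 2 / α ^ 2 + x 1 ^ 2 / β ^ 2 - 1 := by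
    simp [ellipseMatrix, homCoords, Matrix.mulVec_diagonal, dotProduct, Fin.sum_univ_three]
    ring
  rw [conicPoints, Set.mem_ofPred_eq, h, sub_eq_zero]

/-- The quadric `(α² + μ) v² + (β² + μ) w² = d² + μ` of the pencil, for the parameter `μ`. -/
def pencilQuadric (α β μ : ℝ) : Set (Fin 3 → ℝ) :=
  {p | (α ^ 2 + μ) * p 0 ^ 2 + (β ^ 2 + μ) * p 1 ^ 2 = p 2 ^ 2 + μ}

/-! ### The elliptic parametrisation of the lines -/

/-- The modulus `k = √(1 - β²/α²)`. -/
noncomputable def ellipseModulus (α β : ℝ) : ℝ := √(1 - β ^ 2 / α ^ 2)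

theorem norm_jacobiCn_jacobiSn (u k : ℝ) :
    ‖(!₂[jacobiCn u k, jacobiSn u k] : EuclideanSpace ℝ (Fin 2))‖ = 1 := by
  simp [EuclideanSpace.norm_eq, Fin.sum_univ_two, jacobiCn, jacobiSn]

/-- The oriented line `v₊(ψ) = (cn(ψ, k), sn(ψ, k), α dn(ψ, k))`. -/
noncomputable def vPlus (α β ψ : ℝ) : OrientedLine where
  normal := !₂[jacobiCn ψ (ellipseModulus α β), jacobiSn ψ (ellipseModulus α β)]
  norm_normal := norm_jacobiCn_jacobiSn _ _
  offset := α * jacobiDn ψ (ellipseModulus α β)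

/-- The oriented line `v₋(ψ) = (cn(ψ, k), sn(ψ, k), -α dn(ψ, k))`. -/
noncomputable def vMinus (α β ψ : ℝ) : OrientedLine where
  normal := !₂[jacobiCn ψ (ellipseModulus α β), jacobiSn ψ (ellipseModulus α β)]
  norm_normal := norm_jacobiCn_jacobiSn _ _
  offset := -(α * jacobiDn ψ (ellipseModulus α β))

/-!
Everything rests on the addition theorem for `sn`, `cn`, `dn` (`jacobiSn_add`, `jacobiCn_add`,
`jacobiDn_add`): along `u + v = c` the right-hand sides have zero derivative in `u`, so they equal
their value at `u = 0`.

Two consecutive lines of a family are `v₊(τ - h)` and `v₋(τ + h)`, where `h` is `±s/2` or `±s'/2`. By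
the addition theorem their coordinates, multiplied by `1 - k² sn² τ sn² h`, are

`(cn τ cn h ± sn τ sn h dn τ dn h, sn τ cn h dn h ∓ sn h cn τ dn τ,
  α (± dn τ dn h + k² sn τ sn h cn τ cn h))`,

so half their sum and half their difference separate the two signs.

* The difference, divided by `dn τ`, is the direction `(sn τ sn h dn h, -cn τ sn h, α dn h)`. A line
  through two points of a quadric of the pencil lies on it if and only if its direction is isotropic
  (`line_subset_pencilQuadric_iff`), which here reduces to `μ sn² h = α² cn² h`
  (`line_vPlus_vMinus_subset_iff`).
* A black quadrilateral consists of `v₊(τ - h)`, `v₋(τ + h)`, `v₊(τ' + h)`, `v₋(τ' - h)`. Writing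
  `am τ = m + e` and `am τ' = m - e`, the contact conditions of a circle become linear equations that
  are solved in closed form by `blackCircle`, provided `sn h ≠ 0` and `sin e ≠ 0`; replacing `(e, h)`
  by `(-e, -h)` does not change the circle, so contact with the first two lines
  (`blackCircle_contact`) gives contact with the other two. The condition `sin e ≠ 0` fails only if
  `τ` and `τ'` have the same `cn` and `sn`, that is, if `v₊(τ - h)` and `v₋(τ' - h)` have the same
  normal. These lines are then parallel and distinct, because `dn > 0`, and no circle exists.
* Tangency to the ellipse is the dual equation `α² v² + β² w² = d²`, which holds because
  `α² k² = α² - β²`.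
-/

/-! ### Jacobi elliptic functions of a real argument: derivatives and addition theorem -/

section Jacobi

variable {k : ℝ}

theorem ellipticF_strictMono (hk0 : 0 ≤ k) (hk1 : k < 1) : StrictMono (ellipticF k) :=
  strictMono_of_deriv_pos fun φ => by
    rw [(hasDerivAt_ellipticF hk0 hk1 φ).deriv]
    linarith [one_le_deriv_ellipticF hk0 hk1 φ]

theorem ellipticF_jacobiAm (hk0 : 0 ≤ k) (hk1 : k < 1) (u : ℝ) :
    ellipticF k (jacobiAm u k) = u :=
  Function.rightInverse_invFun (ellipticF_bijective hk0 hk1).2 u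

theorem jacobiAm_ellipticF (hk0 : 0 ≤ k) (hk1 : k < 1) (φ : ℝ) :
    jacobiAm (ellipticF k φ) k = φ :=
  Function.leftInverse_invFun (ellipticF_bijective hk0 hk1).1 φ

theorem jacobiAm_zero (hk0 : 0 ≤ k) (hk1 : k < 1) : jacobiAm 0 k = 0 := by
  have h0 : ellipticF k 0 = 0 := by simp [ellipticF]
  simpa [h0] using jacobiAm_ellipticF hk0 hk1 0

theorem ellipticF_neg (k φ : ℝ) : ellipticF k (-φ) = -ellipticF k φ := by
  have h := intervalIntegral.integral_comp_neg (a := 0) (b := φ)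
    (fun θ : ℝ => 1 / √(1 - k ^ 2 * Real.sin θ ^ 2))
  simp only [Real.sin_neg, neg_sq, neg_zero] at h
  rw [ellipticF, ellipticF, h, intervalIntegral.integral_symm]

theorem jacobiAm_neg (hk0 : 0 ≤ k) (hk1 : k < 1) (u : ℝ) : jacobiAm (-u) k = -jacobiAm u k := by
  apply (ellipticF_bijective hk0 hk1).1
  rw [ellipticF_neg, ellipticF_jacobiAm hk0 hk1, ellipticF_jacobiAm hk0 hk1]

theorem jacobiSn_neg (hk0 : 0 ≤ k) (hk1 : k < 1) (u : ℝ) : jacobiSn (-u) k = -jacobiSn u k := by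
  simp [jacobiSn, jacobiAm_neg hk0 hk1]

theorem jacobiCn_neg (hk0 : 0 ≤ k) (hk1 : k < 1) (u : ℝ) : jacobiCn (-u) k = jacobiCn u k := by
  simp [jacobiCn, jacobiAm_neg hk0 hk1]

theorem jacobiDn_neg (hk0 : 0 ≤ k) (hk1 : k < 1) (u : ℝ) : jacobiDn (-u) k = jacobiDn u k := by
  simp [jacobiDn, jacobiSn_neg hk0 hk1]

theorem jacobiSn_zero (hk0 : 0 ≤ k) (hk1 : k < 1) : jacobiSn 0 k = 0 := by
  simp [jacobiSn, jacobiAm_zero hk0 hk1]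

theorem jacobiCn_zero (hk0 : 0 ≤ k) (hk1 : k < 1) : jacobiCn 0 k = 1 := by
  simp [jacobiCn, jacobiAm_zero hk0 hk1]

theorem jacobiDn_zero (hk0 : 0 ≤ k) (hk1 : k < 1) : jacobiDn 0 k = 1 := by
  simp [jacobiDn, jacobiSn_zero hk0 hk1]

theorem jacobiCn_sq (u k : ℝ) : jacobiCn u k ^ 2 = 1 - jacobiSn u k ^ 2 :=
  Real.cos_sq' _

theorem jacobiDn_sq (hk0 : 0 ≤ k) (hk1 : k < 1) (u : ℝ) :
    jacobiDn u k ^ 2 = 1 - k ^ 2 * jacobiSn u k ^ 2 :=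
  Real.sq_sqrt (one_sub_sq_mul_sin_sq_pos hk0 hk1 _).le

theorem jacobiDn_pos (hk0 : 0 ≤ k) (hk1 : k < 1) (u : ℝ) : 0 < jacobiDn u k :=
  Real.sqrt_pos.2 (one_sub_sq_mul_sin_sq_pos hk0 hk1 _)

/-- The denominator of the addition formulas does not vanish. -/
theorem one_sub_sq_mul_jacobiSn_sq_mul_jacobiSn_sq_pos (hk0 : 0 ≤ k) (hk1 : k < 1) (u v : ℝ) :
    0 < 1 - k ^ 2 * jacobiSn u k ^ 2 * jacobiSn v k ^ 2 := by
  have hu := one_sub_sq_mul_sin_sq_pos hk0 hk1 (jacobiAm u k)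
  have hv : jacobiSn v k ^ 2 ≤ 1 := Real.sin_sq_le_one _
  have h := mul_le_mul_of_nonneg_left hv
    (mul_nonneg (sq_nonneg k) (sq_nonneg (jacobiSn u k)))
  simp only [jacobiSn] at h ⊢
  linarith

theorem continuous_jacobiAm (hk0 : 0 ≤ k) (hk1 : k < 1) : Continuous fun u => jacobiAm u k := by
  let e := (ellipticF_strictMono hk0 hk1).orderIsoOfSurjective _ (ellipticF_bijective hk0 hk1).2
  have h : (fun u => jacobiAm u k) = e.symm := by
    funext u
    rw [OrderIso.eq_symm_apply]
    exact ellipticF_jacobiAm hk0 hk1 u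
  rw [h]
  exact e.symm.continuous

theorem hasDerivAt_jacobiAm (hk0 : 0 ≤ k) (hk1 : k < 1) (u : ℝ) :
    HasDerivAt (fun u => jacobiAm u k) (jacobiDn u k) u := by
  have hpos := jacobiDn_pos hk0 hk1 u
  have h : HasDerivAt (ellipticF k) (1 / jacobiDn u k) (jacobiAm u k) :=
    hasDerivAt_ellipticF hk0 hk1 (jacobiAm u k)
  simpa using h.of_local_left_inverse (continuous_jacobiAm hk0 hk1).continuousAt
    (one_div_pos.2 hpos).ne' (Filter.Eventually.of_forall (ellipticF_jacobiAm hk0 hk1))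

theorem hasDerivAt_jacobiSn (hk0 : 0 ≤ k) (hk1 : k < 1) (u : ℝ) :
    HasDerivAt (fun u => jacobiSn u k) (jacobiCn u k * jacobiDn u k) u :=
  (hasDerivAt_jacobiAm hk0 hk1 u).sin

theorem hasDerivAt_jacobiCn (hk0 : 0 ≤ k) (hk1 : k < 1) (u : ℝ) :
    HasDerivAt (fun u => jacobiCn u k) (-jacobiSn u k * jacobiDn u k) u :=
  (hasDerivAt_jacobiAm hk0 hk1 u).cos

theorem hasDerivAt_jacobiDn (hk0 : 0 ≤ k) (hk1 : k < 1) (u : ℝ) :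
    HasDerivAt (fun u => jacobiDn u k) (-(k ^ 2 * jacobiSn u k * jacobiCn u k)) u := by
  have hpos := jacobiDn_pos hk0 hk1 u
  have h := ((((hasDerivAt_jacobiSn hk0 hk1 u).pow 2).const_mul (k ^ 2)).const_sub 1).sqrt
    (one_sub_sq_mul_sin_sq_pos hk0 hk1 (jacobiAm u k)).ne'
  refine h.congr_deriv ?_
  change _ / (2 * jacobiDn u k) = _
  field_simp
  push_cast
  ring

/-- A quotient `N / D` whose derivative vanishes along the whole line is constant. -/
theorem div_eq_div_of_hasDerivAt {N D N' D' : ℝ → ℝ} (hN : ∀ x, HasDerivAt N (N' x) x)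
    (hD : ∀ x, HasDerivAt D (D' x) x) (hD0 : ∀ x, D x ≠ 0)
    (h : ∀ x, N' x * D x - N x * D' x = 0) (x y : ℝ) : N x / D x = N y / D y := by
  refine is_const_of_deriv_eq_zero (f := fun x => N x / D x)
    (fun x => ((hN x).div (hD x) (hD0 x)).differentiableAt) (fun x => ?_) x y
  have h' : deriv (fun x => N x / D x) x = _ := ((hN x).div (hD x) (hD0 x)).deriv
  rw [h', h x, zero_div]

/-- Derivative of the common denominator of the addition formulas along `u + v = c`. -/
theorem hasDerivAt_jacobi_denom (hk0 : 0 ≤ k) (hk1 : k < 1) (c x : ℝ) :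
    HasDerivAt (fun x => 1 - k ^ 2 * jacobiSn x k ^ 2 * jacobiSn (c - x) k ^ 2)
      (-(2 * k ^ 2 * jacobiSn x k * jacobiSn (c - x) k *
        (jacobiCn x k * jacobiDn x k * jacobiSn (c - x) k -
          jacobiSn x k * jacobiCn (c - x) k * jacobiDn (c - x) k))) x := by
  have hs := hasDerivAt_jacobiSn hk0 hk1 x
  have hs' := (hasDerivAt_jacobiSn hk0 hk1 (c - x)).comp_const_sub c x
  refine ((((hs.pow 2).const_mul (k ^ 2)).mul (hs'.pow 2)).const_sub 1).congr_deriv ?_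
  simp only [Pi.pow_apply]
  push_cast
  ring

/-- The addition theorem for `sn`: along `u + v = c` the right-hand side has zero derivative. -/
theorem jacobiSn_add (hk0 : 0 ≤ k) (hk1 : k < 1) (u v : ℝ) :
    jacobiSn (u + v) k =
      (jacobiSn u k * jacobiCn v k * jacobiDn v k + jacobiSn v k * jacobiCn u k * jacobiDn u k) /
        (1 - k ^ 2 * jacobiSn u k ^ 2 * jacobiSn v k ^ 2) := by
  have key := div_eq_div_of_hasDerivAt
    (fun x =>
      have hs := hasDerivAt_jacobiSn hk0 hk1 x
      have hc := hasDerivAt_jacobiCn hk0 hk1 x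
      have hd := hasDerivAt_jacobiDn hk0 hk1 x
      have hs' := (hasDerivAt_jacobiSn hk0 hk1 (u + v - x)).comp_const_sub (u + v) x
      have hc' := (hasDerivAt_jacobiCn hk0 hk1 (u + v - x)).comp_const_sub (u + v) x
      have hd' := (hasDerivAt_jacobiDn hk0 hk1 (u + v - x)).comp_const_sub (u + v) x
      ((hs.mul hc').mul hd').add ((hs'.mul hc).mul hd))
    (hasDerivAt_jacobi_denom hk0 hk1 (u + v))
    (fun x => (one_sub_sq_mul_jacobiSn_sq_mul_jacobiSn_sq_pos hk0 hk1 x (u + v - x)).ne')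
    (fun x => by
      have e1 := jacobiCn_sq x k
      have e2 := jacobiCn_sq (u + v - x) k
      have e3 := jacobiDn_sq hk0 hk1 x
      have e4 := jacobiDn_sq hk0 hk1 (u + v - x)
      simp only [Pi.mul_apply, Pi.add_apply]
      generalize jacobiSn x k = s at *
      generalize jacobiCn x k = c at *
      generalize jacobiDn x k = d at *
      generalize jacobiSn (u + v - x) k = s' at *
      generalize jacobiCn (u + v - x) k = c' at *
      generalize jacobiDn (u + v - x) k = d' at *
      linear_combination (1 - k ^ 2 * s ^ 2 * s' ^ 2) * s * s' * (e4 + k ^ 2 * e2 - e3 - k ^ 2 * e1) +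
        2 * k ^ 2 * s * s' * (s' ^ 2 * (d ^ 2 * e1 + (1 - s ^ 2) * e3) -
          s ^ 2 * (d' ^ 2 * e2 + (1 - s' ^ 2) * e4))) u 0
  simpa [jacobiSn_zero hk0 hk1, jacobiCn_zero hk0 hk1, jacobiDn_zero hk0 hk1] using key.symm

/-- The addition theorem for `cn`. -/
theorem jacobiCn_add (hk0 : 0 ≤ k) (hk1 : k < 1) (u v : ℝ) :
    jacobiCn (u + v) k =
      (jacobiCn u k * jacobiCn v k - jacobiSn u k * jacobiSn v k * jacobiDn u k * jacobiDn v k) /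
        (1 - k ^ 2 * jacobiSn u k ^ 2 * jacobiSn v k ^ 2) := by
  have key := div_eq_div_of_hasDerivAt
    (fun x =>
      have hs := hasDerivAt_jacobiSn hk0 hk1 x
      have hc := hasDerivAt_jacobiCn hk0 hk1 x
      have hd := hasDerivAt_jacobiDn hk0 hk1 x
      have hs' := (hasDerivAt_jacobiSn hk0 hk1 (u + v - x)).comp_const_sub (u + v) x
      have hc' := (hasDerivAt_jacobiCn hk0 hk1 (u + v - x)).comp_const_sub (u + v) x
      have hd' := (hasDerivAt_jacobiDn hk0 hk1 (u + v - x)).comp_const_sub (u + v) x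
      (hc.mul hc').sub (((hs.mul hs').mul hd).mul hd'))
    (hasDerivAt_jacobi_denom hk0 hk1 (u + v))
    (fun x => (one_sub_sq_mul_jacobiSn_sq_mul_jacobiSn_sq_pos hk0 hk1 x (u + v - x)).ne')
    (fun x => by
      have e1 := jacobiCn_sq x k
      have e2 := jacobiCn_sq (u + v - x) k
      have e3 := jacobiDn_sq hk0 hk1 x
      have e4 := jacobiDn_sq hk0 hk1 (u + v - x)
      simp only [Pi.mul_apply, Pi.sub_apply]
      generalize jacobiSn x k = s at *
      generalize jacobiCn x k = c at *
      generalize jacobiDn x k = d at *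
      generalize jacobiSn (u + v - x) k = s' at *
      generalize jacobiCn (u + v - x) k = c' at *
      generalize jacobiDn (u + v - x) k = d' at *
      linear_combination (1 - k ^ 2 * s ^ 2 * s' ^ 2) * (s * c' * d * e4 - c * s' * d' * e3) +
        2 * k ^ 2 * s * s' * (c' * d * s' * (e1 + s ^ 2 * e4) -
          s * c * d' * (e2 + s' ^ 2 * e3))) u 0
  simpa [jacobiSn_zero hk0 hk1, jacobiCn_zero hk0 hk1, jacobiDn_zero hk0 hk1] using key.symm

/-- The addition theorem for `dn`. -/
theorem jacobiDn_add (hk0 : 0 ≤ k) (hk1 : k < 1) (u v : ℝ) :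
    jacobiDn (u + v) k =
      (jacobiDn u k * jacobiDn v k -
          k ^ 2 * jacobiSn u k * jacobiSn v k * jacobiCn u k * jacobiCn v k) /
        (1 - k ^ 2 * jacobiSn u k ^ 2 * jacobiSn v k ^ 2) := by
  have key := div_eq_div_of_hasDerivAt
    (fun x =>
      have hs := hasDerivAt_jacobiSn hk0 hk1 x
      have hc := hasDerivAt_jacobiCn hk0 hk1 x
      have hd := hasDerivAt_jacobiDn hk0 hk1 x
      have hs' := (hasDerivAt_jacobiSn hk0 hk1 (u + v - x)).comp_const_sub (u + v) x
      have hc' := (hasDerivAt_jacobiCn hk0 hk1 (u + v - x)).comp_const_sub (u + v) x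
      have hd' := (hasDerivAt_jacobiDn hk0 hk1 (u + v - x)).comp_const_sub (u + v) x
      (hd.mul hd').sub ((((hs.const_mul (k ^ 2)).mul hs').mul hc).mul hc'))
    (hasDerivAt_jacobi_denom hk0 hk1 (u + v))
    (fun x => (one_sub_sq_mul_jacobiSn_sq_mul_jacobiSn_sq_pos hk0 hk1 x (u + v - x)).ne')
    (fun x => by
      have e1 := jacobiCn_sq x k
      have e2 := jacobiCn_sq (u + v - x) k
      have e3 := jacobiDn_sq hk0 hk1 x
      have e4 := jacobiDn_sq hk0 hk1 (u + v - x)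
      simp only [Pi.mul_apply, Pi.sub_apply]
      generalize jacobiSn x k = s at *
      generalize jacobiCn x k = c at *
      generalize jacobiDn x k = d at *
      generalize jacobiSn (u + v - x) k = s' at *
      generalize jacobiCn (u + v - x) k = c' at *
      generalize jacobiDn (u + v - x) k = d' at *
      linear_combination (1 - k ^ 2 * s ^ 2 * s' ^ 2) * k ^ 2 * (s * c * d' * e2 - s' * c' * d * e1) +
        2 * k ^ 2 * s * s' * (c * s' * d' * (e3 + k ^ 2 * s ^ 2 * e2) -
          s * c' * d * (e4 + k ^ 2 * s' ^ 2 * e1))) u 0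
  simpa [jacobiSn_zero hk0 hk1, jacobiCn_zero hk0 hk1, jacobiDn_zero hk0 hk1] using key.symm

end Jacobi

/-! ### The modulus of the ellipse and the lines `v₊`, `v₋` -/

theorem ellipseModulus_nonneg (α β : ℝ) : 0 ≤ ellipseModulus α β :=
  Real.sqrt_nonneg _

theorem ellipseModulus_sq {α β : ℝ} (hβ : 0 < β) (hαβ : β ≤ α) :
    ellipseModulus α β ^ 2 = 1 - β ^ 2 / α ^ 2 := by
  have hα : 0 < α := hβ.trans_le hαβ
  refine Real.sq_sqrt (sub_nonneg.2 ?_)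
  rw [div_le_one (by positivity)]
  gcongr

theorem ellipseModulus_lt_one {α β : ℝ} (hβ : 0 < β) (hαβ : β ≤ α) : ellipseModulus α β < 1 := by
  have hα : 0 < α := hβ.trans_le hαβ
  have h : 0 < β ^ 2 / α ^ 2 := by positivity
  nlinarith [ellipseModulus_sq hβ hαβ, ellipseModulus_nonneg α β]

theorem sq_mul_ellipseModulus_sq {α β : ℝ} (hβ : 0 < β) (hαβ : β ≤ α) :
    α ^ 2 * ellipseModulus α β ^ 2 = α ^ 2 - β ^ 2 := by
  have hα : α ≠ 0 := (hβ.trans_le hαβ).ne'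
  rw [ellipseModulus_sq hβ hαβ]
  field_simp

theorem vMinus_normal (α β u : ℝ) : (vMinus α β u).normal = (vPlus α β u).normal := rfl

theorem vPlus_normal_eq_iff {α β u v : ℝ} :
    (vPlus α β u).normal = (vPlus α β v).normal ↔
      jacobiCn u (ellipseModulus α β) = jacobiCn v (ellipseModulus α β) ∧
        jacobiSn u (ellipseModulus α β) = jacobiSn v (ellipseModulus α β) := by
  constructor
  · intro h
    exact ⟨by simpa [vPlus] using congrArg (fun x => x 0) h,
      by simpa [vPlus] using congrArg (fun x => x 1) h⟩
  · rintro ⟨h1, h2⟩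
    simp [vPlus, h1, h2]

/-- Equality of normals is equality modulo the period of `(cn, sn)`, hence invariant under shifts of
the argument. The addition theorem gives this without mentioning the period. -/
theorem vPlus_normal_add_eq {α β u v : ℝ} (hβ : 0 < β) (hαβ : β ≤ α) (h : ℝ)
    (huv : (vPlus α β u).normal = (vPlus α β v).normal) :
    (vPlus α β (u + h)).normal = (vPlus α β (v + h)).normal := by
  have hk0 := ellipseModulus_nonneg α β
  have hk1 := ellipseModulus_lt_one hβ hαβ
  obtain ⟨hc, hs⟩ := vPlus_normal_eq_iff.1 huv
  have hd : jacobiDn u (ellipseModulus α β) = jacobiDn v (ellipseModulus α β) := by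
    rw [jacobiDn, hs, jacobiDn]
  rw [vPlus_normal_eq_iff, jacobiCn_add hk0 hk1, jacobiCn_add hk0 hk1, jacobiSn_add hk0 hk1,
    jacobiSn_add hk0 hk1, hc, hs, hd]
  exact ⟨rfl, rfl⟩

theorem vPlus_normal_add_eq_iff {α β : ℝ} (hβ : 0 < β) (hαβ : β ≤ α) (u v h : ℝ) :
    (vPlus α β (u + h)).normal = (vPlus α β (v + h)).normal ↔
      (vPlus α β u).normal = (vPlus α β v).normal := by
  refine ⟨fun H => ?_, vPlus_normal_add_eq hβ hαβ h⟩
  simpa using vPlus_normal_add_eq hβ hαβ (-h) H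

/-- Lines `v₊(u)` and `v₋(v)` with the same normal are parallel and distinct, so no oriented circle
touches both. -/
theorem normal_ne_of_contact {α β u v : ℝ} (hβ : 0 < β) (hαβ : β ≤ α) {C : OrientedCircle}
    (h1 : OrientedContact C (vPlus α β u)) (h2 : OrientedContact C (vMinus α β v)) :
    (vPlus α β u).normal ≠ (vPlus α β v).normal := by
  intro h
  have hα : 0 < α := hβ.trans_le hαβ
  have hk0 := ellipseModulus_nonneg α β
  have hk1 := ellipseModulus_lt_one hβ hαβ
  rw [OrientedContact, h] at h1
  rw [OrientedContact, vMinus_normal] at h2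
  have h3 : (vPlus α β u).offset = (vMinus α β v).offset := h1.symm.trans h2
  simp only [vPlus, vMinus] at h3
  have := mul_pos hα (jacobiDn_pos hk0 hk1 u)
  have := mul_pos hα (jacobiDn_pos hk0 hk1 v)
  linarith

/-! ### The common circle of four lines -/

/-- The oriented circle with centre
`(α cos m / (sn h sin e), α dn h sin m / (sn h sin e))` and signed radius `α cs h cot e`. With
`am τ = m + e` and `am τ' = m - e` it touches `v₊(τ - h)`, `v₋(τ + h)`, `v₊(τ' + h)`
and `v₋(τ' - h)`; meaningful where `sn h ≠ 0` and `sin e ≠ 0`. -/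
noncomputable def blackCircle (α β m e h : ℝ) : OrientedCircle where
  center := !₂[α * Real.cos m / (jacobiSn h (ellipseModulus α β) * Real.sin e),
    α * jacobiDn h (ellipseModulus α β) * Real.sin m /
      (jacobiSn h (ellipseModulus α β) * Real.sin e)]
  radius := α * jacobiCn h (ellipseModulus α β) * Real.cos e /
    (jacobiSn h (ellipseModulus α β) * Real.sin e)

theorem blackCircle_neg_neg {α β : ℝ} (hβ : 0 < β) (hαβ : β ≤ α) (m e h : ℝ) :
    blackCircle α β m (-e) (-h) = blackCircle α β m e h := by
  have hk0 := ellipseModulus_nonneg α β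
  have hk1 := ellipseModulus_lt_one hβ hαβ
  simp only [blackCircle, jacobiSn_neg hk0 hk1, jacobiCn_neg hk0 hk1, jacobiDn_neg hk0 hk1,
    Real.sin_neg, Real.cos_neg, neg_mul_neg]

/-- By the addition theorem, the conditions of contact with `v₊(τ - h)` and `v₋(τ + h)` are the sum
and the difference of the identities `even` and `odd` below, up to factors. -/
theorem blackCircle_contact {α β : ℝ} (hβ : 0 < β) (hαβ : β ≤ α) {m e h τ : ℝ}
    (hh : jacobiSn h (ellipseModulus α β) ≠ 0) (he : Real.sin e ≠ 0)
    (hτ : jacobiAm τ (ellipseModulus α β) = m + e) :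
    OrientedContact (blackCircle α β m e h) (vPlus α β (τ - h)) ∧
      OrientedContact (blackCircle α β m e h) (vMinus α β (τ + h)) := by
  have hk0 := ellipseModulus_nonneg α β
  have hk1 := ellipseModulus_lt_one hβ hαβ
  have hD := one_sub_sq_mul_jacobiSn_sq_mul_jacobiSn_sq_pos hk0 hk1 τ h
  have hs : jacobiSn τ (ellipseModulus α β) =
      Real.sin m * Real.cos e + Real.cos m * Real.sin e := by rw [jacobiSn, hτ, Real.sin_add]
  have hc : jacobiCn τ (ellipseModulus α β) =
      Real.cos m * Real.cos e - Real.sin m * Real.sin e := by rw [jacobiCn, hτ, Real.cos_add]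
  have hdh := jacobiDn_sq hk0 hk1 h
  have hm := Real.sin_sq_add_cos_sq m
  have hee := Real.sin_sq_add_cos_sq e
  simp only [OrientedContact, blackCircle, vPlus, vMinus, PiLp.inner_apply, Fin.sum_univ_two,
    sub_eq_add_neg τ h, jacobiSn_add hk0 hk1, jacobiCn_add hk0 hk1, jacobiDn_add hk0 hk1,
    jacobiSn_neg hk0 hk1, jacobiCn_neg hk0 hk1, jacobiDn_neg hk0 hk1]
  simp
  generalize ellipseModulus α β = k at *
  generalize jacobiSn τ k = sτ at *
  generalize jacobiCn τ k = cτ at *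
  generalize jacobiDn τ k = dτ at *
  generalize jacobiSn h k = sh at *
  generalize jacobiCn h k = ch at *
  generalize jacobiDn h k = dh at *
  generalize Real.sin m = x at *
  generalize Real.cos m = y at *
  generalize Real.sin e = p at *
  generalize Real.cos e = q at *
  have odd : y * sτ - x * cτ = p := by
    rw [hs, hc]; linear_combination p * hm
  have even : y * cτ * ch + dh * x * sτ * ch * dh - ch * q * (1 - k ^ 2 * sτ ^ 2 * sh ^ 2) =
      k ^ 2 * sτ * sh * cτ * ch * (sh * p) := by
    have a1 : y * cτ + x * sτ = q := by rw [hs, hc]; linear_combination q * hm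
    have a2 : q * sτ - p * cτ = x := by rw [hs, hc]; linear_combination x * hee
    linear_combination ch * x * sτ * hdh + ch * a1 + k ^ 2 * sh ^ 2 * sτ * ch * a2
  clear hs hc hm hee hdh
  generalize 1 - k ^ 2 * sτ ^ 2 * sh ^ 2 = D at *
  have hD' := hD.ne'
  constructor
  · field_simp
    linear_combination α * even + α * dτ * sh * dh * odd
  · field_simp
    linear_combination α * even - α * dτ * sh * dh * odd

/-- Used with negated shift, where the lines `v₋` come first. -/
theorem haveCommonCircle_swap (l₁ l₂ l₃ l₄ : OrientedLine) :
    HaveCommonCircle l₁ l₂ l₃ l₄ ↔ HaveCommonCircle l₂ l₁ l₄ l₃ :=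
  exists_congr fun _ => by tauto

/-- The four lines have a common circle unless `v₊(a)` and `v₋(b - s)` have the same normal: with
`h = s / 2`, `τ = a + h` and `τ' = b - h`, vanishing of `sin ((am τ - am τ') / 2)` would make the
normals at `τ` and `τ'`, hence those at `a` and `b - s`, agree. -/
theorem haveCommonCircle_iff {α β : ℝ} (hβ : 0 < β) (hαβ : β ≤ α) {s : ℝ} (a b : ℝ)
    (hs : jacobiSn (s / 2) (ellipseModulus α β) ≠ 0) :
    HaveCommonCircle (vPlus α β a) (vMinus α β (a + s)) (vPlus α β b) (vMinus α β (b - s)) ↔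
      (vPlus α β a).normal ≠ (vPlus α β (b - s)).normal := by
  have hk0 := ellipseModulus_nonneg α β
  have hk1 := ellipseModulus_lt_one hβ hαβ
  constructor
  · rintro ⟨C, h1, -, -, h4⟩
    exact normal_ne_of_contact hβ hαβ h1 h4
  · intro hne
    rw [Ne, ← vPlus_normal_add_eq_iff hβ hαβ _ _ (s / 2)] at hne
    set φ := jacobiAm (a + s / 2) (ellipseModulus α β) with hφ
    set φ' := jacobiAm (b - s + s / 2) (ellipseModulus α β) with hφ'
    have he : Real.sin ((φ - φ') / 2) ≠ 0 := by
      intro h0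
      refine hne (vPlus_normal_eq_iff.2 ⟨?_, ?_⟩) <;> rw [← sub_eq_zero]
      · rw [jacobiCn, jacobiCn, Real.cos_sub_cos, ← hφ, ← hφ', h0, mul_zero]
      · rw [jacobiSn, jacobiSn, Real.sin_sub_sin, ← hφ, ← hφ', h0, mul_zero, zero_mul]
    obtain ⟨h1, h2⟩ := blackCircle_contact hβ hαβ (m := (φ + φ') / 2) hs he
      (τ := a + s / 2) (by rw [← hφ]; ring)
    obtain ⟨h3, h4⟩ := blackCircle_contact hβ hαβ (m := (φ + φ') / 2) (e := -((φ - φ') / 2))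
      (h := -(s / 2)) (τ := b - s + s / 2) (by simpa [jacobiSn_neg hk0 hk1] using hs)
      (by simpa using he) (by rw [← hφ']; ring)
    rw [blackCircle_neg_neg hβ hαβ] at h3 h4
    rw [add_sub_cancel_right] at h1
    rw [add_assoc, add_halves] at h2
    rw [sub_neg_eq_add, add_assoc, add_halves, sub_add_cancel] at h3
    rw [add_neg_cancel_right] at h4
    exact ⟨_, h1, h2, h3, h4⟩

/-! ### Tangency to the ellipse -/

/-- The tangent of the ellipse at the point `(α² v / d, β² w / d)` is the line `(v, w, d)`. -/
theorem isTangentToConic_ellipseMatrix {α β : ℝ} (hα : α ≠ 0) (hβ : β ≠ 0) (l : OrientedLine)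
    (h0 : l.offset ≠ 0)
    (h : α ^ 2 * l.normal 0 ^ 2 + β ^ 2 * l.normal 1 ^ 2 = l.offset ^ 2) :
    IsTangentToConic (ellipseMatrix α β) l := by
  refine ⟨!₂[α ^ 2 * l.normal 0 / l.offset, β ^ 2 * l.normal 1 / l.offset], ?_, ?_⟩
  · rw [mem_conicPoints_ellipseMatrix]
    simp
    field_simp
    exact h
  · ext x
    simp only [OrientedLine.points, Set.mem_ofPred_eq, PiLp.inner_apply, Fin.sum_univ_two]
    simp [ellipseMatrix, homCoords, Matrix.mulVec_diagonal, dotProduct, Fin.sum_univ_three]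
    field_simp
    rw [mul_zero, ← sub_eq_add_neg, sub_eq_zero]

theorem mul_jacobiDn_sq {α β : ℝ} (hβ : 0 < β) (hαβ : β ≤ α) (u : ℝ) :
    α ^ 2 * jacobiCn u (ellipseModulus α β) ^ 2 + β ^ 2 * jacobiSn u (ellipseModulus α β) ^ 2 =
      (α * jacobiDn u (ellipseModulus α β)) ^ 2 := by
  have h := sq_mul_ellipseModulus_sq hβ hαβ
  rw [mul_pow, jacobiDn_sq (ellipseModulus_nonneg α β) (ellipseModulus_lt_one hβ hαβ),
    jacobiCn_sq]
  linear_combination jacobiSn u (ellipseModulus α β) ^ 2 * h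

theorem mul_jacobiDn_pos {α β : ℝ} (hβ : 0 < β) (hαβ : β ≤ α) (u : ℝ) :
    0 < α * jacobiDn u (ellipseModulus α β) :=
  mul_pos (hβ.trans_le hαβ)
    (jacobiDn_pos (ellipseModulus_nonneg α β) (ellipseModulus_lt_one hβ hαβ) u)

theorem isTangentToConic_vPlus {α β : ℝ} (hβ : 0 < β) (hαβ : β ≤ α) (u : ℝ) :
    IsTangentToConic (ellipseMatrix α β) (vPlus α β u) :=
  isTangentToConic_ellipseMatrix (hβ.trans_le hαβ).ne' hβ.ne' _ (mul_jacobiDn_pos hβ hαβ u).ne'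
    (by simpa [vPlus] using mul_jacobiDn_sq hβ hαβ u)

theorem isTangentToConic_vMinus {α β : ℝ} (hβ : 0 < β) (hαβ : β ≤ α) (u : ℝ) :
    IsTangentToConic (ellipseMatrix α β) (vMinus α β u) :=
  isTangentToConic_ellipseMatrix (hβ.trans_le hαβ).ne' hβ.ne' _
    (neg_ne_zero.2 (mul_jacobiDn_pos hβ hαβ u).ne')
    (by simpa [vMinus] using mul_jacobiDn_sq hβ hαβ u)

theorem ellipseMatrix_isSymm (α β : ℝ) : (ellipseMatrix α β).IsSymm :=
  Matrix.isSymm_diagonal _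

theorem ellipseMatrix_det_ne_zero {α β : ℝ} (hα : α ≠ 0) (hβ : β ≠ 0) :
    (ellipseMatrix α β).det ≠ 0 := by
  simp [ellipseMatrix, Matrix.det_diagonal, Fin.prod_univ_three, hα, hβ]

/-! ### Lines on the quadrics of the pencil -/

/-- A line through two points of a quadric of the pencil lies on the quadric if and only if its
direction is isotropic. -/
theorem line_subset_pencilQuadric_iff {α β μ : ℝ} {P Q : Fin 3 → ℝ}
    (hP : P ∈ pencilQuadric α β μ) (hQ : Q ∈ pencilQuadric α β μ) :
    (line[ℝ, P, Q] : Set (Fin 3 → ℝ)) ⊆ pencilQuadric α β μ ↔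
      (α ^ 2 + μ) * (Q 0 - P 0) ^ 2 + (β ^ 2 + μ) * (Q 1 - P 1) ^ 2 = (Q 2 - P 2) ^ 2 := by
  simp only [pencilQuadric, Set.mem_ofPred_eq] at hP hQ
  constructor
  · intro H
    -- the midpoint of `P` and `Q` already forces the direction to be isotropic
    have h := H (AffineMap.lineMap_mem_affineSpan_pair (2⁻¹ : ℝ) P Q)
    simp [pencilQuadric, AffineMap.lineMap_apply] at h
    linear_combination 2 * hP + 2 * hQ - 4 * h
  · rintro H x hx
    obtain ⟨t, rfl⟩ := mem_affineSpan_pair_iff_exists_lineMap_eq.1 hx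
    simp [pencilQuadric, AffineMap.lineMap_apply]
    linear_combination (1 - t) * hP + t * hQ - t * (1 - t) * H

theorem vPlus_mem_pencilQuadric {α β : ℝ} (hβ : 0 < β) (hαβ : β ≤ α) (u μ : ℝ) :
    (vPlus α β u).toBlaschke ∈ pencilQuadric α β μ := by
  have h := mul_jacobiDn_sq hβ hαβ u
  have h' := jacobiCn_sq u (ellipseModulus α β)
  simp [pencilQuadric, OrientedLine.toBlaschke, vPlus]
  linear_combination h + μ * h'

theorem vMinus_mem_pencilQuadric {α β : ℝ} (hβ : 0 < β) (hαβ : β ≤ α) (u μ : ℝ) :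
    (vMinus α β u).toBlaschke ∈ pencilQuadric α β μ := by
  have h := mul_jacobiDn_sq hβ hαβ u
  have h' := jacobiCn_sq u (ellipseModulus α β)
  simp [pencilQuadric, OrientedLine.toBlaschke, vMinus]
  linear_combination h + μ * h'

/-- By the addition theorem the line joining `v₊(τ - h)` and `v₋(τ + h)` has the direction
`(sn τ sn h dn h, -cn τ sn h, α dn h)`, up to the factor `-2 dn τ / (1 - k² sn² τ sn² h)`; it
is isotropic if and only if `μ sn² h = α² cn² h`. -/
theorem line_vPlus_vMinus_subset_iff {α β : ℝ} (hβ : 0 < β) (hαβ : β ≤ α) (τ h μ : ℝ)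
    (hh : jacobiSn h (ellipseModulus α β) ≠ 0) :
    (line[ℝ, (vPlus α β (τ - h)).toBlaschke, (vMinus α β (τ + h)).toBlaschke] :
        Set (Fin 3 → ℝ)) ⊆ pencilQuadric α β μ ↔
      μ = α ^ 2 * jacobiCs h (ellipseModulus α β) ^ 2 := by
  have hk0 := ellipseModulus_nonneg α β
  have hk1 := ellipseModulus_lt_one hβ hαβ
  have hD := (one_sub_sq_mul_jacobiSn_sq_mul_jacobiSn_sq_pos hk0 hk1 τ h).ne'
  have hdτ := (jacobiDn_pos hk0 hk1 τ).ne'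
  have hdh := jacobiDn_sq hk0 hk1 h
  have hcτ := jacobiCn_sq τ (ellipseModulus α β)
  have hch := jacobiCn_sq h (ellipseModulus α β)
  have hk := sq_mul_ellipseModulus_sq hβ hαβ
  rw [line_subset_pencilQuadric_iff (vPlus_mem_pencilQuadric hβ hαβ _ μ)
    (vMinus_mem_pencilQuadric hβ hαβ _ μ)]
  simp only [OrientedLine.toBlaschke, vPlus, vMinus,
    sub_eq_add_neg τ h, jacobiSn_add hk0 hk1, jacobiCn_add hk0 hk1, jacobiDn_add hk0 hk1,
    jacobiSn_neg hk0 hk1, jacobiCn_neg hk0 hk1, jacobiDn_neg hk0 hk1, jacobiCs]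
  simp
  generalize ellipseModulus α β = k at *
  generalize jacobiSn τ k = sτ at *
  generalize jacobiCn τ k = cτ at *
  generalize jacobiDn τ k = dτ at *
  generalize jacobiSn h k = sh at *
  generalize jacobiCn h k = ch at *
  generalize jacobiDn h k = dh at *
  generalize hDd : 1 - k ^ 2 * sτ ^ 2 * sh ^ 2 = D at *
  have isotropy : (α ^ 2 + μ) * (sτ * sh * dh) ^ 2 + (β ^ 2 + μ) * (sh * cτ) ^ 2 - (α * dh) ^ 2 =
      D * (μ * sh ^ 2 - α ^ 2 * ch ^ 2) := by
    linear_combination ((α ^ 2 + μ) * sτ ^ 2 * sh ^ 2 - α ^ 2) * hdh + (β ^ 2 + μ) * sh ^ 2 * hcτ +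
      α ^ 2 * D * hch + sh ^ 2 * (1 - sτ ^ 2) * hk + (μ * sh ^ 2 - α ^ 2 * (1 - sh ^ 2)) * hDd
  clear hdh hcτ hch hk hDd
  have hμ : μ = α ^ 2 * (ch / sh) ^ 2 ↔ μ * sh ^ 2 - α ^ 2 * ch ^ 2 = 0 := by
    rw [sub_eq_zero]
    field_simp
  have h4 : 4 * dτ ^ 2 / D ≠ 0 := by positivity
  rw [hμ, ← sub_eq_zero, ← mul_eq_zero_iff_left h4 (b := μ * sh ^ 2 - α ^ 2 * ch ^ 2)]
  refine Eq.congr_left ?_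
  field_simp
  linear_combination 4 * dτ ^ 2 * isotropy

theorem line_vPlus_vMinus_add_subset_iff {α β : ℝ} (hβ : 0 < β) (hαβ : β ≤ α) (a s μ : ℝ)
    (hs : jacobiSn (s / 2) (ellipseModulus α β) ≠ 0) :
    (line[ℝ, (vPlus α β a).toBlaschke, (vMinus α β (a + s)).toBlaschke] : Set (Fin 3 → ℝ)) ⊆
        pencilQuadric α β μ ↔
      μ = α ^ 2 * jacobiCs (s / 2) (ellipseModulus α β) ^ 2 := by
  simpa only [add_sub_cancel_right, add_assoc, add_halves] using
    line_vPlus_vMinus_subset_iff hβ hαβ (a + s / 2) (s / 2) μ hs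

theorem line_vPlus_vMinus_sub_subset_iff {α β : ℝ} (hβ : 0 < β) (hαβ : β ≤ α) (a s μ : ℝ)
    (hs : jacobiSn (s / 2) (ellipseModulus α β) ≠ 0) :
    (line[ℝ, (vPlus α β a).toBlaschke, (vMinus α β (a - s)).toBlaschke] : Set (Fin 3 → ℝ)) ⊆
        pencilQuadric α β μ ↔
      μ = α ^ 2 * jacobiCs (s / 2) (ellipseModulus α β) ^ 2 := by
  have hk0 := ellipseModulus_nonneg α β
  have hk1 := ellipseModulus_lt_one hβ hαβ
  have H := line_vPlus_vMinus_add_subset_iff hβ hαβ a (-s) μ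
    (by simpa [neg_div, jacobiSn_neg hk0 hk1] using hs)
  simpa [← sub_eq_add_neg, neg_div, jacobiCs, jacobiSn_neg hk0 hk1, jacobiCn_neg hk0 hk1,
    div_neg] using H

/-! ### The checkerboard net -/

theorem mainTheorem2 (α β : ℝ) (hβ : 0 < β) (hαβ : β ≤ α) (ψv ψh s s' : ℝ)
    (hs : jacobiSn (s / 2) (ellipseModulus α β) ≠ 0)
    (hs' : jacobiSn (s' / 2) (ellipseModulus α β) ≠ 0)
    (l m : ℤ → OrientedLine)
    (hl_even : ∀ n : ℤ, l (2 * n) = vPlus α β (ψv + n * (s + s')))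
    (hl_odd : ∀ n : ℤ, l (2 * n + 1) = vMinus α β (ψv + n * (s + s') + s))
    (hm_even : ∀ n : ℤ, m (2 * n) = vPlus α β (ψh - n * (s + s')))
    (hm_odd : ∀ n : ℤ, m (2 * n + 1) = vMinus α β (ψh - n * (s + s') - s)) :
    -- every black quadrilateral has an inscribed circle, unless two of its lines are
    -- parallel with equal unit normals (and then no such circle exists)
    (∀ i j : ℤ, Even (i + j) →
      (HaveCommonCircle (l i) (l (i + 1)) (m j) (m (j + 1)) ↔
        (l i).normal ≠ (m (j + 1)).normal)) ∧
    -- if this never happens, the lines form a confocal checkerboard IC-net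
    ((∀ i j : ℤ, Odd (i + j) → (l i).normal ≠ (m j).normal) →
      IsConfocalCheckerboardICNet l m) ∧
    -- all lines are tangent to the given ellipse
    (∀ i : ℤ, IsTangentToConic (ellipseMatrix α β) (l i) ∧
      IsTangentToConic (ellipseMatrix α β) (m i)) ∧
    -- the associated hyperboloids of the pencil
    (∀ n : ℤ, ∀ μ : ℝ,
      ((line[ℝ, (l (2 * n)).toBlaschke, (l (2 * n + 1)).toBlaschke] : Set (Fin 3 → ℝ)) ⊆
          pencilQuadric α β μ ↔ μ = α ^ 2 * jacobiCs (s / 2) (ellipseModulus α β) ^ 2) ∧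
      ((line[ℝ, (m (2 * n)).toBlaschke, (m (2 * n + 1)).toBlaschke] : Set (Fin 3 → ℝ)) ⊆
          pencilQuadric α β μ ↔ μ = α ^ 2 * jacobiCs (s / 2) (ellipseModulus α β) ^ 2) ∧
      ((line[ℝ, (l (2 * n + 1)).toBlaschke, (l (2 * n + 2)).toBlaschke] : Set (Fin 3 → ℝ)) ⊆
          pencilQuadric α β μ ↔ μ = α ^ 2 * jacobiCs (s' / 2) (ellipseModulus α β) ^ 2) ∧
      ((line[ℝ, (m (2 * n + 1)).toBlaschke, (m (2 * n + 2)).toBlaschke] : Set (Fin 3 → ℝ)) ⊆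
          pencilQuadric α β μ ↔ μ = α ^ 2 * jacobiCs (s' / 2) (ellipseModulus α β) ^ 2)) := by
  have hk0 := ellipseModulus_nonneg α β
  have hk1 := ellipseModulus_lt_one hβ hαβ
  have black : ∀ i j : ℤ, Even (i + j) →
      (HaveCommonCircle (l i) (l (i + 1)) (m j) (m (j + 1)) ↔
        (l i).normal ≠ (m (j + 1)).normal) := by
    intro i j hij
    rcases Int.even_or_odd' i with ⟨a, rfl | rfl⟩ <;> rcases Int.even_or_odd' j with ⟨b, rfl | rfl⟩
    · rw [hl_even, hl_odd, hm_even, hm_odd, vMinus_normal]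
      exact haveCommonCircle_iff hβ hαβ _ _ hs
    · exact absurd hij (by grind)
    · exact absurd hij (by grind)
    · -- shifting the base points by one step turns this quadrilateral into the previous one,
      -- with `-s'` in place of `s`
      have H := haveCommonCircle_iff hβ hαβ (s := -s') (ψv + (a + 1) * (s + s'))
        (ψh - (b + 1) * (s + s')) (by simpa [neg_div, jacobiSn_neg hk0 hk1] using hs')
      rw [Ne, ← vPlus_normal_add_eq_iff hβ hαβ _ _ (-s'), sub_add_cancel] at H
      rw [show 2 * a + 1 + 1 = 2 * (a + 1) by ring, show 2 * b + 1 + 1 = 2 * (b + 1) by ring,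
        hl_even, hl_odd, hm_even, hm_odd, vMinus_normal, haveCommonCircle_swap,
        show ψv + a * (s + s') + s = ψv + (a + 1) * (s + s') + -s' by ring,
        show ψh - b * (s + s') - s = ψh - (b + 1) * (s + s') - -s' by ring]
      push_cast
      exact H
  have tangent : ∀ i : ℤ, IsTangentToConic (ellipseMatrix α β) (l i) ∧
      IsTangentToConic (ellipseMatrix α β) (m i) := by
    intro i
    rcases Int.even_or_odd' i with ⟨a, rfl | rfl⟩
    · rw [hl_even, hm_even]
      exact ⟨isTangentToConic_vPlus hβ hαβ _, isTangentToConic_vPlus hβ hαβ _⟩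
    · rw [hl_odd, hm_odd]
      exact ⟨isTangentToConic_vMinus hβ hαβ _, isTangentToConic_vMinus hβ hαβ _⟩
  refine ⟨black, fun hne => ⟨fun a b => ⟨?_, ?_⟩, ellipseMatrix α β, ellipseMatrix_isSymm α β,
    ellipseMatrix_det_ne_zero (hβ.trans_le hαβ).ne' hβ.ne', tangent⟩, tangent, ?_⟩
  · exact (black _ _ ⟨a + b, by ring⟩).2 (hne _ _ ⟨a + b, by ring⟩)
  · have H := (black (2 * a - 1) (2 * b - 1) ⟨a + b - 1, by ring⟩).2
      (hne _ _ ⟨a + b - 1, by ring⟩)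
    simpa only [sub_add_cancel] using H
  intro n μ
  rw [show 2 * n + 2 = 2 * (n + 1) by ring, hl_even, hl_odd, hm_even, hm_odd, hl_even, hm_even]
  push_cast
  refine ⟨line_vPlus_vMinus_add_subset_iff hβ hαβ _ _ _ hs,
    line_vPlus_vMinus_sub_subset_iff hβ hαβ _ _ _ hs, ?_, ?_⟩
  · rw [Set.pair_comm, show ψv + n * (s + s') + s = ψv + (n + 1) * (s + s') - s' by ring]
    exact line_vPlus_vMinus_sub_subset_iff hβ hαβ _ _ _ hs'
  · rw [Set.pair_comm, show ψh - n * (s + s') - s = ψh - (n + 1) * (s + s') + s' by ring]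
    exact line_vPlus_vMinus_add_subset_iff hβ hαβ _ _ _ hs'
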